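/- Let $\mathbb{D}$ be the open unit disk, let $K\ge 1$ and put $k=\frac{K-1}{K+1}$. Let $\mathcal{S}^*$ be the class of analytic functions $f(z)=z+\sum_{m\ge2}a_mz^m$ on $\mathbb{D}$ such that $zf'(z)/f(z)$ is subordinate to $(1+z)/(1-z)$. (For functions on $\mathbb{D}$, $u$ is subordinate to $v$, written $u\prec v$, if $u=v\circ w$ for an analytic $w:\mathbb{D}\to\mathbb{D}$ with $w(0)=0$.) Put $$r_0=\frac{5K+1-\sqrt{8K(3K+1)}}{K+1}.$$ Then $0<r_0<\frac13$, and the following hold. (i) Let $h=f+\overline{g}$ be a sense-preserving $K$-quasiconformal harmonic mapping of $\mathbb{D}$, with $f\in\mathcal{S}^*$, $g$ analytic in $\mathbb{D}$ and $g(0)=0$, and let $h_1=f_1+\overline{g_1}\prec h$, where $f_1(z)=\sum_{m\ge1}c_mz^m$ and $g_1(z)=\sum_{m\ge1}d_mz^m$ are analytic in $\mathbb{D}$. Then $$\sum_{m=1}^{\infty}(|c_m|+|d_m|)\,r^m\le d\bigl(f(0),\partial f(\mathbb{D})\bigr)\qquad\text{for all } 0\le r\le r_0,$$ where $d$ is the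 Euclidean distance. It is not needed here that $h$ be injective: it suffices that $|g'|<|f'|$ and $|f'|+|g'|\le K(|f'|-|g'|)$ on $\mathbb{D}$. (ii) The radius $r_0$ is sharp: with $f_0(z)=z/(1-z)^2\in\mathcal{S}^*$, the function $p=f_0+k\overline{f_0}$ is a sense-preserving $K$-quasiconformal harmonic mapping (a homeomorphism of $\mathbb{D}$ onto its open image), and for $h=h_1=p$ equality holds in the above inequality at $r=r_0$, while the inequality fails for every $r$ with $r_0<r<1$. -/

import Mathlib

open Metric Set
open scoped ComplexConjugate

noncomputable section

/-- The open unit disk `𝔻`. -/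
def unitDisk : Set ℂ := ball (0 : ℂ) 1

/-- The `m`-th Taylor coefficient of `f` at the origin. -/
def taylorCoeff (f : ℂ → ℂ) (m : ℕ) : ℂ := iteratedDeriv m f 0 / (m.factorial : ℂ)

/-- A Schwarz function: an analytic self-map of the unit disk that fixes the origin. -/
structure IsSchwarz (w : ℂ → ℂ) : Prop where
  analytic : DifferentiableOn ℂ w unitDisk
  mapsTo : MapsTo w unitDisk unitDisk
  map_zero : w 0 = 0

/-- Subordination `u ≺ v` on the unit disk (for analytic or harmonic `u`, `v`):
`u = v ∘ w` for some Schwarz function `w`. -/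
def Subordinate (u v : ℂ → ℂ) : Prop :=
  ∃ w : ℂ → ℂ, IsSchwarz w ∧ ∀ z ∈ unitDisk, u z = v (w z)

/-- The class `𝒜` of analytic functions `f(z) = z + ∑_{m ≥ 2} a_m z^m` on the unit disk. -/
def classA : Set (ℂ → ℂ) :=
  {f | DifferentiableOn ℂ f unitDisk ∧ f 0 = 0 ∧ deriv f 0 = 1}

/-- The function `z f'(z) / f(z)`, with its removable singularity at the origin filled in
(for `f ∈ 𝒜` the value there is `1`). -/
def starlikeQuotient (f : ℂ → ℂ) (z : ℂ) : ℂ :=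
  if z = 0 then 1 else z * deriv f z / f z

/-- The Ma-Minda class `𝒮*(ψ)`: those `f ∈ 𝒜` with `z f'(z) / f(z) ≺ ψ(z)`. The requirement that
`f` has no zero other than the origin says that the quotient is a genuine function on the disk. -/
def maMindaStarlike (ψ : ℂ → ℂ) : Set (ℂ → ℂ) :=
  {f | f ∈ classA ∧ (∀ z ∈ unitDisk, z ≠ 0 → f z ≠ 0) ∧ Subordinate (starlikeQuotient f) ψ}

/-- The classical class `𝒮*` of starlike functions: `𝒮*(ψ)` with `ψ(z) = (1 + z) / (1 - z)`. -/
def starlikeClass : Set (ℂ → ℂ) := maMindaStarlike fun z => (1 + z) / (1 - z)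

/-- The harmonic function `f + conj g`. -/
def harmonicMap (f g : ℂ → ℂ) (z : ℂ) : ℂ := f z + conj (g z)

/-- `h = f + conj g`, with `f`, `g` analytic on the disk and `g 0 = 0`, is sense-preserving and
has maximal dilatation at most `K`. Here `∂h/∂z = f'` and `∂h/∂z̄ = conj g'`, so the Jacobian is
`|f'|² - |g'|²`, and the last field is `(|h_z| + |h_z̄|) / (|h_z| - |h_z̄|) ≤ K`, that is,
`|g' / f'| ≤ (K - 1) / (K + 1)`. Global injectivity is not required. -/
structure IsSensePreservingDilatationLE (K : ℝ) (f g : ℂ → ℂ) : Prop where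
  analytic_left : DifferentiableOn ℂ f unitDisk
  analytic_right : DifferentiableOn ℂ g unitDisk
  right_zero : g 0 = 0
  sense_preserving : ∀ z ∈ unitDisk, ‖deriv g z‖ < ‖deriv f z‖
  dilatation_le : ∀ z ∈ unitDisk,
    ‖deriv f z‖ + ‖deriv g z‖ ≤ K * (‖deriv f z‖ - ‖deriv g z‖)

/-- `h = f + conj g` is a sense-preserving `K`-quasiconformal harmonic mapping of the disk: in
addition to the dilatation bound, `h` is a homeomorphism of the disk onto an open set. -/
structure IsQuasiconformalHarmonic (K : ℝ) (f g : ℂ → ℂ) : Prop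
    extends IsSensePreservingDilatationLE K f g where
  homeo : Topology.IsOpenEmbedding (fun z : unitDisk => harmonicMap f g z)

/-- `h₁ = f₁ + conj g₁` (with `f₁`, `g₁` analytic on the disk and `g₁ 0 = 0`) belongs to the class
of harmonic functions subordinate to `h = f + conj g`. -/
structure IsHarmonicSubordinate (f₁ g₁ f g : ℂ → ℂ) : Prop where
  analytic_left : DifferentiableOn ℂ f₁ unitDisk
  analytic_right : DifferentiableOn ℂ g₁ unitDisk
  right_zero : g₁ 0 = 0
  subordinate : Subordinate (harmonicMap f₁ g₁) (harmonicMap f g)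

/-- The term of index `m` of `∑_{m ≥ 1} (|c_m| + |d_m|) r^m` is the value at `m - 1` of this
sequence, where `c_m`, `d_m` are the Taylor coefficients of `f₁`, `g₁`. -/
def bohrTerm (f₁ g₁ : ℂ → ℂ) (r : ℝ) (n : ℕ) : ℝ :=
  (‖taylorCoeff f₁ (n + 1)‖ + ‖taylorCoeff g₁ (n + 1)‖) * r ^ (n + 1)

/-- The Euclidean distance `d(f(0), ∂f(𝔻))`. -/
def boundaryDist (f : ℂ → ℂ) : ℝ := infDist (f 0) (frontier (f '' unitDisk))

/-- The radius `r₀ = (5K + 1 - √(8K(3K + 1))) / (K + 1)`. -/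
def bohrRadius (K : ℝ) : ℝ := (5 * K + 1 - √(8 * K * (3 * K + 1))) / (K + 1)

/-- The Koebe function `z / (1 - z)²`. -/
def koebe (z : ℂ) : ℂ := z / (1 - z) ^ 2

/-- `k` times the Koebe function, where `k = (K - 1) / (K + 1)`. -/
def scaledKoebe (K : ℝ) (z : ℂ) : ℂ := (((K - 1) / (K + 1) : ℝ) : ℂ) * koebe z

end

/-! Let `h₁ = h ∘ w` with `w` a Schwarz function. Then `f₁ - f ∘ w` is the conjugate of `g ∘ w -
g₁`, so both are constant, and beyond index 0 the coefficients of `f₁`, `g₁` are those of `f ∘ w`,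
`g ∘ w`.

For `r ≤ 1/3`, Bohr's theorem (`partialMajorant_le_of_norm_le`) says that a factor bounded by `C`
enlarges a majorant series at most `C` times. With the factor `w(z)/z`, bounded by 1, this shows
that composition with `w` does not increase the majorant (`IsSchwarz.partialMajorant_comp_le`). With
the factor `g'/f'`, bounded by `k`, it bounds the majorant of `g` by `k` times that of `f`
(`partialMajorant_le_mul_of_norm_deriv_le`).

Since `|a_n| ≤ n` for starlike `f`, the Bohr sum is at most `(1 + k) ∑ n r^n = 2K/(K+1) · r/(1-r)²`.
This increases with `r` and equals `1/4` at `r₀`, while `1/4` is Koebe's lower bound for the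
boundary distance. For the Koebe function all these estimates are equalities, hence sharpness.

The estimates concern partial sums only, so convergence comes at the end, from a uniform bound. -/

lemma zero_mem_unitDisk : (0 : ℂ) ∈ unitDisk := mem_ball_self one_pos

lemma mem_unitDisk_iff {z : ℂ} : z ∈ unitDisk ↔ ‖z‖ < 1 := mem_ball_zero_iff

lemma isOpen_unitDisk : IsOpen unitDisk := isOpen_ball

lemma unitDisk_mem_nhds_zero : unitDisk ∈ nhds (0 : ℂ) :=
  isOpen_unitDisk.mem_nhds zero_mem_unitDisk

lemma DifferentiableOn.contDiffAt_zero {f : ℂ → ℂ} (hf : DifferentiableOn ℂ f unitDisk)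
    (n : WithTop ℕ∞) : ContDiffAt ℂ n f 0 :=
  (hf.analyticAt unitDisk_mem_nhds_zero).contDiffAt

/-! ### Algebra of Taylor coefficients -/

lemma taylorCoeff_zero (f : ℂ → ℂ) : taylorCoeff f 0 = f 0 := by simp [taylorCoeff]

lemma taylorCoeff_one (f : ℂ → ℂ) : taylorCoeff f 1 = deriv f 0 := by simp [taylorCoeff]

lemma taylorCoeff_congr {f g : ℂ → ℂ} (h : EqOn f g unitDisk) (n : ℕ) :
    taylorCoeff f n = taylorCoeff g n := by
  have : f =ᶠ[nhds 0] g := Filter.eventuallyEq_of_mem unitDisk_mem_nhds_zero h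
  simp only [taylorCoeff, (this.iteratedDeriv n).eq_of_nhds]

lemma taylorCoeff_deriv (f : ℂ → ℂ) (n : ℕ) :
    taylorCoeff (deriv f) n = (n + 1) * taylorCoeff f (n + 1) := by
  have h1 : (n.factorial : ℂ) ≠ 0 := Nat.cast_ne_zero.2 n.factorial_ne_zero
  have h2 : (n + 1 : ℂ) ≠ 0 := Nat.cast_add_one_ne_zero n
  simp only [taylorCoeff, iteratedDeriv_succ', Nat.factorial_succ, Nat.cast_mul, Nat.cast_add,
    Nat.cast_one]
  field_simp

lemma taylorCoeff_mul {f g : ℂ → ℂ} (hf : DifferentiableOn ℂ f unitDisk)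
    (hg : DifferentiableOn ℂ g unitDisk) (n : ℕ) :
    taylorCoeff (fun z => f z * g z) n =
      ∑ p ∈ Finset.HasAntidiagonal.antidiagonal n, taylorCoeff f p.1 * taylorCoeff g p.2 := by
  rw [Finset.Nat.sum_antidiagonal_eq_sum_range_succ_mk, taylorCoeff,
    iteratedDeriv_fun_mul (hf.contDiffAt_zero n) (hg.contDiffAt_zero n), Finset.sum_div]
  refine Finset.sum_congr rfl fun i hi => ?_
  have hi' : i ≤ n := Nat.lt_succ_iff.1 (Finset.mem_range.1 hi)
  have h0 := Nat.choose_mul_factorial_mul_factorial hi'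
  have h1 : (i.factorial : ℂ) ≠ 0 := Nat.cast_ne_zero.2 i.factorial_ne_zero
  have h2 : ((n - i).factorial : ℂ) ≠ 0 := Nat.cast_ne_zero.2 (n - i).factorial_ne_zero
  have h3 : (n.factorial : ℂ) ≠ 0 := Nat.cast_ne_zero.2 n.factorial_ne_zero
  simp only [taylorCoeff]
  rw [div_mul_div_comm, div_eq_div_iff h3 (mul_ne_zero h1 h2), ← h0]
  push_cast
  ring

lemma taylorCoeff_const_mul (c : ℂ) (f : ℂ → ℂ) (n : ℕ) :
    taylorCoeff (fun z => c * f z) n = c * taylorCoeff f n := by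
  simp only [taylorCoeff, mul_div_assoc', iteratedDeriv_const_mul_field]

lemma taylorCoeff_const_add_of_pos (c : ℂ) (f : ℂ → ℂ) {n : ℕ} (hn : 0 < n) :
    taylorCoeff (fun z => c + f z) n = taylorCoeff f n := by
  simp only [taylorCoeff, iteratedDeriv_const_add hn]

lemma taylorCoeff_const_sub_of_pos (c : ℂ) (f : ℂ → ℂ) {n : ℕ} (hn : 0 < n) :
    taylorCoeff (fun z => c - f z) n = -taylorCoeff f n := by
  simp only [taylorCoeff, iteratedDeriv_const_sub hn, iteratedDeriv_neg, neg_div]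

lemma taylorCoeff_id (n : ℕ) : taylorCoeff (fun z => z) n = if n = 1 then 1 else 0 := by
  match n with
  | 0 => simp [taylorCoeff_zero]
  | 1 => simp [taylorCoeff_one]
  | n + 2 =>
    have : deriv (fun z : ℂ => z) = fun _ => 1 := by ext z; simp
    simp [taylorCoeff, iteratedDeriv_succ', this]

lemma taylorCoeff_id_mul_succ {f : ℂ → ℂ} (hf : DifferentiableOn ℂ f unitDisk) (n : ℕ) :
    taylorCoeff (fun z => z * f z) (n + 1) = taylorCoeff f n := by
  rw [taylorCoeff_mul (f := fun z => z) differentiableOn_id hf, Finset.Nat.sum_antidiagonal_succ]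
  cases n <;> simp [taylorCoeff_id, Finset.Nat.sum_antidiagonal_succ]

lemma taylorCoeff_id_mul_deriv {f : ℂ → ℂ} (hf : DifferentiableOn ℂ f unitDisk) (n : ℕ) :
    taylorCoeff (fun z => z * deriv f z) n = n * taylorCoeff f n := by
  cases n with
  | zero => simp [taylorCoeff_zero]
  | succ n =>
    rw [taylorCoeff_id_mul_succ (hf.deriv isOpen_unitDisk), taylorCoeff_deriv]
    push_cast
    rfl

/-! ### Carathéodory's estimate -/

/-- Carathéodory's coefficient estimate on a circle of radius `ρ < 1`. -/
lemma norm_taylorCoeff_mul_pow_le_of_re_nonneg {p : ℂ → ℂ} (hp : DifferentiableOn ℂ p unitDisk)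
    (hre : ∀ z ∈ unitDisk, 0 ≤ (p z).re) {n : ℕ} (hn : n ≠ 0) {ρ : ℝ} (h0 : 0 < ρ) (h1 : ρ < 1) :
    ‖taylorCoeff p n‖ * ρ ^ n ≤ 2 * (p 0).re := by
  have hsub : closedBall (0 : ℂ) ρ ⊆ unitDisk := closedBall_subset_ball h1
  have hpρ : DifferentiableOn ℂ p (closedBall 0 ρ) := hp.mono hsub
  have habs : |ρ| = ρ := abs_of_pos h0
  have hmean {F : ℂ → ℂ} (hF : DifferentiableOn ℂ F (closedBall 0 ρ)) :
      Real.circleAverage F 0 ρ = F 0 := by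
    apply DiffContOnCl.circleAverage
    rw [habs]
    exact (hF.mono closure_ball_subset_closedBall).diffContOnCl
  have hsph : sphere (0 : ℂ) ρ ⊆ closedBall 0 ρ := sphere_subset_closedBall
  have hint {F : ℂ → ℂ} (hF : ContinuousOn F (sphere 0 ρ)) : CircleIntegrable F 0 ρ :=
    hF.circleIntegrable h0.le
  have hcp : ContinuousOn p (sphere 0 ρ) := hpρ.continuousOn.mono hsph
  have hne : ∀ z ∈ sphere (0 : ℂ) ρ, z ≠ 0 := fun z hz => ne_of_mem_sphere hz h0.ne'
  have hcinv : ContinuousOn (fun z : ℂ => (z⁻¹) ^ n) (sphere 0 ρ) :=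
    (continuousOn_id.inv₀ hne).pow n
  -- Against `z⁻ⁿ`, `p` averages to its coefficient and `conj p` to zero. Adding the two replaces
  -- `p` by `2 Re p ≥ 0`, whose absolute value averages to `2 Re p(0)`.
  have hA1 : Real.circleAverage (fun z => (z⁻¹) ^ n * p z) 0 ρ = taylorCoeff p n := by
    rw [Real.circleAverage_eq_circleIntegral h0.ne']
    have := hpρ.circleIntegral_one_div_sub_center_pow_smul h0 n
    simp only [sub_zero, smul_eq_mul] at this ⊢
    rw [show (fun z : ℂ => z⁻¹ * ((z⁻¹) ^ n * p z)) = fun z => 1 / z ^ (n + 1) * p z by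
      ext z; rw [one_div, ← inv_pow, pow_succ]; ring, this, taylorCoeff]
    have := Complex.two_pi_I_ne_zero
    field_simp
  -- On the circle `z⁻¹ = conj z / ρ²`, so the integrand is a multiple of the conjugate of `zⁿ
  -- p(z)`, which vanishes at the centre.
  have hA2 : Real.circleAverage (fun z => (z⁻¹) ^ n * conj (p z)) 0 ρ = 0 := by
    have e1 : Real.circleAverage (fun z => z ^ n * p z) 0 ρ = 0 := by
      rw [hmean (F := fun z => z ^ n * p z) ((differentiableOn_id.pow n).mul hpρ)]; simp [hn]
    have e2 := (Complex.conjCLE : ℂ →L[ℝ] ℂ).circleAverage_comp_comm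
      (hint (F := fun z => z ^ n * p z) ((continuousOn_id.pow n).mul hcp))
    have e3 := Real.circleAverage_fun_smul (a := ((ρ : ℂ) ^ (2 * n))⁻¹) (c := 0) (R := ρ)
      (f := (Complex.conjCLE : ℂ →L[ℝ] ℂ) ∘ fun z => z ^ n * p z)
    rw [show Real.circleAverage (⇑(Complex.conjCLE : ℂ →L[ℝ] ℂ) ∘ fun z => z ^ n * p z) 0 ρ = 0 by
      rw [e2, e1, map_zero], smul_zero] at e3
    refine Eq.trans ?_ e3
    apply Real.circleAverage_congr_sphere
    rw [habs]
    intro z hz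
    have hz0 := hne z hz
    have hzz : z * conj z = (ρ : ℂ) ^ 2 := by
      rw [Complex.mul_conj']; simp [mem_sphere_zero_iff_norm.1 hz]
    have hcz : conj z ≠ 0 := by simpa using hz0
    simp only [Function.comp, smul_eq_mul, ContinuousLinearEquiv.coe_coe, Complex.conjCLE_apply,
      map_mul, map_pow, pow_mul, ← hzz, mul_pow, inv_pow, mul_inv]
    field_simp
  have hsum : taylorCoeff p n =
      Real.circleAverage (fun z => (z⁻¹) ^ n * (2 * (p z).re : ℝ)) 0 ρ := by
    have := Real.circleAverage_fun_add (hint (hcinv.mul hcp))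
      (hint (hcinv.mul (Complex.continuous_conj.comp_continuousOn hcp)))
    refine (hA1.symm.trans ((add_zero _).symm.trans ?_)).trans (this.symm.trans ?_)
    · exact congrArg (_ + ·) hA2.symm
    · congr 1
      ext z
      simp only [Pi.mul_apply, Function.comp]
      rw [← mul_add, Complex.add_conj]
  have hRe : Real.circleAverage (fun z => (p z).re) 0 ρ = (p 0).re := by
    rw [← hmean hpρ]
    exact Complex.reCLM.circleAverage_comp_comm (hint hcp)
  have hbound : ‖taylorCoeff p n‖ ≤
      Real.circleAverage (fun z => (2 * (ρ ^ n)⁻¹) • (p z).re) 0 ρ := by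
    rw [hsum, Real.circleAverage, Real.circleAverage, norm_smul, smul_eq_mul,
      Real.norm_of_nonneg (by positivity)]
    refine mul_le_mul_of_nonneg_left ?_ (by positivity)
    refine (intervalIntegral.norm_integral_le_integral_norm (by positivity)).trans_eq ?_
    refine intervalIntegral.integral_congr fun θ _ => ?_
    have hθ : circleMap 0 ρ θ ∈ unitDisk := hsub (hsph (circleMap_mem_sphere _ h0.le _))
    simp only [norm_mul, norm_pow, norm_inv, norm_circleMap_zero, habs, Complex.norm_real,
      smul_eq_mul, inv_pow, Real.norm_ofNat, Real.norm_of_nonneg (hre _ hθ)]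
    ring
  rw [Real.circleAverage_fun_smul, hRe, smul_eq_mul] at hbound
  calc _ ≤ 2 * (ρ ^ n)⁻¹ * (p 0).re * ρ ^ n := by gcongr
    _ = _ := by have := h0.ne'; field_simp

/-- **Carathéodory's coefficient estimate**: a function of nonnegative real part on the disk has
`n`-th Taylor coefficient of modulus at most `2 Re p(0)`. -/
theorem norm_taylorCoeff_le_of_re_nonneg {p : ℂ → ℂ} (hp : DifferentiableOn ℂ p unitDisk)
    (hre : ∀ z ∈ unitDisk, 0 ≤ (p z).re) {n : ℕ} (hn : n ≠ 0) :
    ‖taylorCoeff p n‖ ≤ 2 * (p 0).re := by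
  have ht : Filter.Tendsto (fun ρ : ℝ => ‖taylorCoeff p n‖ * ρ ^ n) (nhdsWithin 1 (Iio 1))
      (nhds (‖taylorCoeff p n‖ * 1 ^ n)) :=
    ((continuous_const.mul (continuous_pow n)).tendsto 1).mono_left nhdsWithin_le_nhds
  rw [one_pow, mul_one] at ht
  refine le_of_tendsto ht ?_
  filter_upwards [Ioo_mem_nhdsLT (zero_lt_one (α := ℝ))] with ρ hρ
  exact norm_taylorCoeff_mul_pow_le_of_re_nonneg hp hre hn hρ.1 hρ.2

/-! ### Majorant series and Bohr's theorem -/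

/-- The partial sum `∑_{m < N} |a_m| r^m` of the majorant series of `f = ∑ a_m z^m`. -/
noncomputable def partialMajorant (f : ℂ → ℂ) (r : ℝ) (N : ℕ) : ℝ :=
  ∑ m ∈ Finset.range N, ‖taylorCoeff f m‖ * r ^ m

lemma partialMajorant_nonneg (f : ℂ → ℂ) {r : ℝ} (hr : 0 ≤ r) (N : ℕ) :
    0 ≤ partialMajorant f r N :=
  Finset.sum_nonneg fun _ _ => by positivity

lemma partialMajorant_succ (f : ℂ → ℂ) (r : ℝ) (N : ℕ) :
    partialMajorant f r (N + 1) =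
      ‖f 0‖ + ∑ m ∈ Finset.range N, ‖taylorCoeff f (m + 1)‖ * r ^ (m + 1) := by
  rw [partialMajorant, Finset.sum_range_succ', taylorCoeff_zero, pow_zero, mul_one, add_comm]

/-- The pairs with `i + j < N` form part of the square `i, j < N`, and the remaining terms are
nonnegative. -/
lemma sum_range_antidiagonal_le {a b : ℕ → ℝ} (ha : ∀ n, 0 ≤ a n) (hb : ∀ n, 0 ≤ b n) {r : ℝ}
    (hr : 0 ≤ r) (N : ℕ) :
    ∑ m ∈ Finset.range N, (∑ p ∈ Finset.HasAntidiagonal.antidiagonal m, a p.1 * b p.2) * r ^ m ≤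
      (∑ m ∈ Finset.range N, a m * r ^ m) * ∑ m ∈ Finset.range N, b m * r ^ m := by
  set T := (Finset.range N ×ˢ Finset.range N).filter fun p => p.1 + p.2 < N with hT
  calc _ = ∑ m ∈ Finset.range N, ∑ p ∈ T with p.1 + p.2 = m,
        (a p.1 * r ^ p.1) * (b p.2 * r ^ p.2) := by
        refine Finset.sum_congr rfl fun m hm => ?_
        rw [Finset.sum_mul]
        have hm := Finset.mem_range.1 hm
        have : T.filter (fun p => p.1 + p.2 = m) = Finset.HasAntidiagonal.antidiagonal m := by
          ext ⟨i, j⟩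
          simp only [hT, Finset.mem_filter, Finset.mem_product, Finset.mem_range,
            Finset.HasAntidiagonal.mem_antidiagonal]
          omega
        rw [this]
        refine Finset.sum_congr rfl fun p hp => ?_
        rw [← Finset.HasAntidiagonal.mem_antidiagonal.1 hp, pow_add]
        ring
    _ = ∑ p ∈ T, (a p.1 * r ^ p.1) * (b p.2 * r ^ p.2) :=
        Finset.sum_fiberwise_of_maps_to
          (fun p hp => Finset.mem_range.2 (Finset.mem_filter.1 hp).2) _
    _ ≤ ∑ p ∈ Finset.range N ×ˢ Finset.range N, (a p.1 * r ^ p.1) * (b p.2 * r ^ p.2) :=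
        Finset.sum_le_sum_of_subset_of_nonneg (Finset.filter_subset _ _) fun p _ _ =>
          mul_nonneg (mul_nonneg (ha _) (pow_nonneg hr _)) (mul_nonneg (hb _) (pow_nonneg hr _))
    _ = _ := by rw [Finset.sum_mul_sum, Finset.sum_product]

lemma norm_taylorCoeff_mul_le {f g : ℂ → ℂ} (hf : DifferentiableOn ℂ f unitDisk)
    (hg : DifferentiableOn ℂ g unitDisk) (n : ℕ) :
    ‖taylorCoeff (fun z => f z * g z) n‖ ≤ ∑ p ∈ Finset.HasAntidiagonal.antidiagonal n,
      ‖taylorCoeff f p.1‖ * ‖taylorCoeff g p.2‖ := by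
  rw [taylorCoeff_mul hf hg]
  exact (norm_sum_le _ _).trans_eq (by simp only [norm_mul])

lemma partialMajorant_mul_le {f g : ℂ → ℂ} (hf : DifferentiableOn ℂ f unitDisk)
    (hg : DifferentiableOn ℂ g unitDisk) {r : ℝ} (hr : 0 ≤ r) (N : ℕ) :
    partialMajorant (fun z => f z * g z) r N ≤ partialMajorant f r N * partialMajorant g r N := by
  refine le_trans (Finset.sum_le_sum fun m _ => ?_) (sum_range_antidiagonal_le
    (fun n => norm_nonneg (taylorCoeff f n)) (fun n => norm_nonneg (taylorCoeff g n)) hr N)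
  gcongr
  exact norm_taylorCoeff_mul_le hf hg m

/-- For unimodular `u` with `u φ(0) = |φ(0)|`, Carathéodory's estimate applies to `C - u φ`. -/
lemma norm_taylorCoeff_le_of_norm_le {φ : ℂ → ℂ} (hφ : DifferentiableOn ℂ φ unitDisk) {C : ℝ}
    (hC : ∀ z ∈ unitDisk, ‖φ z‖ ≤ C) {n : ℕ} (hn : n ≠ 0) :
    ‖taylorCoeff φ n‖ ≤ 2 * (C - ‖φ 0‖) := by
  obtain ⟨u, hu, hu0⟩ := Complex.exists_norm_eq_mul_self (φ 0)
  have key := norm_taylorCoeff_le_of_re_nonneg (p := fun z => (C : ℂ) - u * φ z)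
    ((hφ.const_mul u).const_sub _) (fun z hz => ?_) hn
  · rwa [taylorCoeff_const_sub_of_pos _ _ (Nat.pos_of_ne_zero hn), norm_neg,
      taylorCoeff_const_mul, norm_mul, hu, one_mul, ← hu0, Complex.sub_re, Complex.ofReal_re,
      Complex.ofReal_re] at key
  · have := (Complex.re_le_norm (u * φ z)).trans_eq (by rw [norm_mul, hu, one_mul])
    simpa using this.trans (hC z hz)

/-- **Bohr's theorem**: the majorant series of a function bounded by `C` on the disk is at most `C`
for `r ≤ 1 / 3`. -/
theorem partialMajorant_le_of_norm_le {φ : ℂ → ℂ} (hφ : DifferentiableOn ℂ φ unitDisk) {C : ℝ}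
    (hC : ∀ z ∈ unitDisk, ‖φ z‖ ≤ C) {r : ℝ} (hr : 0 ≤ r) (hr3 : r ≤ 1 / 3) (N : ℕ) :
    partialMajorant φ r N ≤ C := by
  have h0 := hC 0 zero_mem_unitDisk
  cases N with
  | zero => simpa [partialMajorant] using (norm_nonneg _).trans h0
  | succ N =>
    -- This is where `1/3` enters: the geometric tail is at most `1/2`, which cancels the 2 of the
    -- coefficient estimate.
    have hgeom : ∑ m ∈ Finset.range N, r ^ (m + 1) ≤ 1 / 2 := by
      have h1 : (∑ m ∈ Finset.range N, r ^ m) ≤ (1 - r)⁻¹ :=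
        sum_le_hasSum _ (fun _ _ => by positivity)
          (hasSum_geometric_of_lt_one hr (by linarith))
      have h2 : (1 - r)⁻¹ ≤ 3 / 2 := by
        rw [inv_le_comm₀ (by linarith) (by norm_num)]; linarith
      simp only [pow_succ, ← Finset.sum_mul]
      have h3 : 0 ≤ ∑ m ∈ Finset.range N, r ^ m := Finset.sum_nonneg fun _ _ => by positivity
      nlinarith
    rw [partialMajorant_succ]
    calc _ ≤ ‖φ 0‖ + ∑ m ∈ Finset.range N, 2 * (C - ‖φ 0‖) * r ^ (m + 1) := by
          gcongr with m
          exact norm_taylorCoeff_le_of_norm_le hφ hC m.succ_ne_zero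
      _ ≤ ‖φ 0‖ + 2 * (C - ‖φ 0‖) * (1 / 2) := by
          rw [← Finset.mul_sum]
          gcongr
      _ = C := by ring

/-! ### Majorants under composition and under a dilatation bound -/

lemma differentiableOn_dslope_zero {f : ℂ → ℂ} (hf : DifferentiableOn ℂ f unitDisk) :
    DifferentiableOn ℂ (dslope f 0) unitDisk :=
  (Complex.differentiableOn_dslope unitDisk_mem_nhds_zero).2 hf

lemma eq_add_mul_dslope_zero (f : ℂ → ℂ) (z : ℂ) : f z = f 0 + z * dslope f 0 z := by
  have := sub_smul_dslope f 0 z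
  rw [sub_zero, smul_eq_mul] at this
  rw [this]; ring

lemma IsSchwarz.norm_dslope_le {w : ℂ → ℂ} (hw : IsSchwarz w) {z : ℂ} (hz : z ∈ unitDisk) :
    ‖dslope w 0 z‖ ≤ 1 := by
  have h : MapsTo w (ball 0 1) (closedBall (w 0) 1) := fun x hx => by
    rw [hw.map_zero]; exact ball_subset_closedBall (hw.mapsTo hx)
  simpa using Complex.norm_dslope_le_div_of_mapsTo_ball hw.analytic h hz

lemma IsSchwarz.norm_le {w : ℂ → ℂ} (hw : IsSchwarz w) {z : ℂ} (hz : z ∈ unitDisk) :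
    ‖w z‖ ≤ ‖z‖ := by
  rw [eq_add_mul_dslope_zero w z, hw.map_zero, zero_add, norm_mul]
  exact mul_le_of_le_one_right (norm_nonneg _) (hw.norm_dslope_le hz)

/-- The majorant series of `f ∘ w`, for a Schwarz function `w`, is dominated by that of `f` for
`r ≤ 1 / 3`. -/
theorem IsSchwarz.partialMajorant_comp_le {w : ℂ → ℂ} (hw : IsSchwarz w) {r : ℝ} (hr : 0 ≤ r)
    (hr3 : r ≤ 1 / 3) (N : ℕ) {f : ℂ → ℂ} (hf : DifferentiableOn ℂ f unitDisk) :
    partialMajorant (fun z => f (w z)) r N ≤ partialMajorant f r N := by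
  -- Writing `f = f(0) + z F` gives `f ∘ w = f(0) + z · (w(z)/z) · (F ∘ w)`. The factor `z` lowers
  -- the length by one, and the induction hypothesis is used for `F`.
  induction N generalizing f with
  | zero => simp [partialMajorant]
  | succ N ih =>
    set F := dslope f 0
    have hF : DifferentiableOn ℂ F unitDisk := differentiableOn_dslope_zero hf
    have hFw : DifferentiableOn ℂ (fun z => F (w z)) unitDisk := hF.comp hw.analytic hw.mapsTo
    have hφ := differentiableOn_dslope_zero hw.analytic
    have shift {H : ℂ → ℂ} (hH : DifferentiableOn ℂ H unitDisk) (c : ℂ) :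
        partialMajorant (fun z => c + z * H z) r (N + 1) = ‖c‖ + r * partialMajorant H r N := by
      rw [partialMajorant_succ, zero_mul, add_zero, partialMajorant, Finset.mul_sum]
      congr 1
      refine Finset.sum_congr rfl fun m _ => ?_
      rw [taylorCoeff_const_add_of_pos _ _ m.succ_pos, taylorCoeff_id_mul_succ hH, pow_succ]
      ring
    have e1 : (fun z => f (w z)) = fun z => f 0 + z * (dslope w 0 z * F (w z)) := by
      ext z
      rw [eq_add_mul_dslope_zero f (w z), ← mul_assoc]
      congr 2
      rw [eq_add_mul_dslope_zero w z, hw.map_zero, zero_add]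
    have e2 : f = fun z => f 0 + z * F z := funext (eq_add_mul_dslope_zero f)
    have h2 : partialMajorant f r (N + 1) = ‖f 0‖ + r * partialMajorant F r N := by
      rw [← shift hF, ← e2]
    rw [e1, shift (H := fun z => dslope w 0 z * F (w z)) (hφ.mul hFw), h2]
    gcongr
    calc _ ≤ partialMajorant (dslope w 0) r N * partialMajorant (fun z => F (w z)) r N :=
          partialMajorant_mul_le hφ hFw hr N
      _ ≤ 1 * partialMajorant F r N := by
          gcongr
          · exact partialMajorant_nonneg _ hr N
          · exact partialMajorant_le_of_norm_le hφ (fun z hz => hw.norm_dslope_le hz) hr hr3 N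
          · exact ih hF
      _ = _ := one_mul _

/-- If `|g'| ≤ k |f'|` on the disk and `g(0) = 0`, the majorant series of `g` is at most `k` times
that of `f` for `r ≤ 1 / 3`. -/
theorem partialMajorant_le_mul_of_norm_deriv_le {f g : ℂ → ℂ}
    (hf : DifferentiableOn ℂ f unitDisk) (hg : DifferentiableOn ℂ g unitDisk) (hg0 : g 0 = 0)
    (hne : ∀ z ∈ unitDisk, deriv f z ≠ 0) {k : ℝ}
    (hk : ∀ z ∈ unitDisk, ‖deriv g z‖ ≤ k * ‖deriv f z‖) {r : ℝ} (hr : 0 ≤ r) (hr3 : r ≤ 1 / 3)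
    (N : ℕ) : partialMajorant g r N ≤ k * partialMajorant f r N := by
  have hf' := hf.deriv isOpen_unitDisk
  have hg' := hg.deriv isOpen_unitDisk
  set ω : ℂ → ℂ := fun z => deriv g z / deriv f z with hω
  have hωd : DifferentiableOn ℂ ω unitDisk := hg'.div hf' hne
  have hωk : ∀ z ∈ unitDisk, ‖ω z‖ ≤ k := fun z hz => by
    rw [hω, norm_div, div_le_iff₀ (norm_pos_iff.2 (hne z hz))]
    exact hk z hz
  -- Comparing coefficients in `z g' = ω · z f'` gives `m b_m = ∑ ω_i j a_j` over `i + j = m`; as `j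
  -- ≤ m`, dividing by `m` only helps.
  have hcoeff (m : ℕ) : ‖taylorCoeff g m‖ ≤ ∑ p ∈ Finset.HasAntidiagonal.antidiagonal m,
      ‖taylorCoeff ω p.1‖ * ‖taylorCoeff f p.2‖ := by
    rcases Nat.eq_zero_or_pos m with rfl | hm
    · simp only [taylorCoeff_zero, hg0, norm_zero]
      positivity
    · have hm' : (0 : ℝ) < m := Nat.cast_pos.2 hm
      refine le_of_mul_le_mul_left ?_ hm'
      calc (m : ℝ) * ‖taylorCoeff g m‖
          = ‖taylorCoeff (fun z => ω z * (z * deriv f z)) m‖ := by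
            rw [← Complex.norm_natCast, ← norm_mul, ← taylorCoeff_id_mul_deriv hg]
            congr 1
            refine taylorCoeff_congr (fun z hz => ?_) m
            have := hne z hz
            simp only [hω]
            field_simp
        _ ≤ _ := norm_taylorCoeff_mul_le hωd (differentiableOn_id.mul hf') m
        _ ≤ _ := by
            rw [Finset.mul_sum]
            refine Finset.sum_le_sum fun p hp => ?_
            have := Finset.HasAntidiagonal.mem_antidiagonal.1 hp
            have : (p.2 : ℝ) ≤ m := Nat.cast_le.2 (by omega)
            have e : ‖taylorCoeff (fun z => z * deriv f z) p.2‖ = p.2 * ‖taylorCoeff f p.2‖ := by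
              rw [taylorCoeff_id_mul_deriv hf, norm_mul, Complex.norm_natCast]
            calc ‖taylorCoeff ω p.1‖ * ‖taylorCoeff (fun z => z * deriv f z) p.2‖
                = (p.2 : ℝ) * (‖taylorCoeff ω p.1‖ * ‖taylorCoeff f p.2‖) := by rw [e]; ring
              _ ≤ _ := by gcongr
  calc _ ≤ ∑ m ∈ Finset.range N, (∑ p ∈ Finset.HasAntidiagonal.antidiagonal m,
        ‖taylorCoeff ω p.1‖ * ‖taylorCoeff f p.2‖) * r ^ m :=
        Finset.sum_le_sum fun m _ => mul_le_mul_of_nonneg_right (hcoeff m) (pow_nonneg hr m)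
    _ ≤ partialMajorant ω r N * partialMajorant f r N :=
        sum_range_antidiagonal_le (fun n => norm_nonneg (taylorCoeff ω n))
          (fun n => norm_nonneg (taylorCoeff f n)) hr N
    _ ≤ _ := mul_le_mul_of_nonneg_right (partialMajorant_le_of_norm_le hωd hωk hr hr3 N)
        (partialMajorant_nonneg f hr N)

/-! ### Starlike functions: coefficients, growth, univalence -/

lemma IsSchwarz.one_sub_ne_zero {w : ℂ → ℂ} (hw : IsSchwarz w) {z : ℂ} (hz : z ∈ unitDisk) :
    1 - w z ≠ 0 := fun h => by
  have := mem_unitDisk_iff.1 (hw.mapsTo hz)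
  rw [← sub_eq_zero.1 h, norm_one] at this
  exact this.false

/-- The real part is the Poisson kernel `(1 - |w|²)/|1 - w|²`, and `|1 - w| ≤ 1 + |w|`. -/
lemma one_sub_norm_div_le_re_cayley {w : ℂ} (hw : ‖w‖ < 1) :
    (1 - ‖w‖) / (1 + ‖w‖) ≤ ((1 + w) / (1 - w)).re := by
  have h1 : 1 - w ≠ 0 := fun h => by
    rw [← sub_eq_zero.1 h, norm_one] at hw
    exact hw.false
  have e : ((1 + w) / (1 - w)).re = (1 - ‖w‖ ^ 2) / ‖1 - w‖ ^ 2 := by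
    rw [Complex.div_re, ← Complex.normSq_eq_norm_sq, ← Complex.normSq_eq_norm_sq, ← add_div]
    congr 1
    simp [Complex.normSq_apply]
    ring
  have h2 : ‖1 - w‖ ≤ 1 + ‖w‖ := (norm_sub_le _ _).trans_eq (by rw [norm_one])
  have h3 : 0 < ‖1 - w‖ := norm_pos_iff.2 h1
  have h4 : 0 ≤ 1 - ‖w‖ ^ 2 := by nlinarith [norm_nonneg w]
  have h5 : 0 < 1 + ‖w‖ := by positivity
  rw [e]
  calc _ = (1 - ‖w‖ ^ 2) / (1 + ‖w‖) ^ 2 := by field_simp; ring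
    _ ≤ _ := by gcongr

/-- The function `p = z f' / f` of a starlike `f`. -/
lemma exists_of_mem_starlikeClass {f : ℂ → ℂ} (hf : f ∈ starlikeClass) :
    ∃ p : ℂ → ℂ, DifferentiableOn ℂ p unitDisk ∧ p 0 = 1 ∧
      (∀ z ∈ unitDisk, z * deriv f z = f z * p z) ∧
      ∀ z ∈ unitDisk, (1 - ‖z‖) / (1 + ‖z‖) ≤ (p z).re := by
  obtain ⟨⟨-, hf0, -⟩, hne, w, hw, hsub⟩ := hf
  refine ⟨fun z => (1 + w z) / (1 - w z),
    (hw.analytic.const_add 1).div (hw.analytic.const_sub 1) fun z hz => hw.one_sub_ne_zero hz,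
    by simp [hw.map_zero], fun z hz => ?_, fun z hz => ?_⟩
  · by_cases h : z = 0
    · simp [h, hf0]
    · rw [← hsub z hz, starlikeQuotient, if_neg h, mul_div_cancel₀ _ (hne z hz h)]
  -- The bound decreases in the modulus, and `|w(z)| ≤ |z|` by the Schwarz lemma.
  · refine le_trans ?_ (one_sub_norm_div_le_re_cayley (mem_unitDisk_iff.1 (hw.mapsTo hz)))
    have := hw.norm_le hz
    have := mem_unitDisk_iff.1 hz
    rw [div_le_div_iff₀ (by positivity) (by positivity)]
    nlinarith

/-- The coefficient estimate `|a_n| ≤ n` for starlike functions. -/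
theorem norm_taylorCoeff_le_of_mem_starlikeClass {f : ℂ → ℂ} (hf : f ∈ starlikeClass) (n : ℕ) :
    ‖taylorCoeff f n‖ ≤ n := by
  obtain ⟨p, hp, hp0, hfp, hre⟩ := exists_of_mem_starlikeClass hf
  obtain ⟨⟨hfd, hf0, hf1⟩, -, -⟩ := hf
  have hpn {m : ℕ} (hm : m ≠ 0) : ‖taylorCoeff p m‖ ≤ 2 := by
    refine (norm_taylorCoeff_le_of_re_nonneg hp (fun z hz => le_trans ?_ (hre z hz)) hm).trans_eq
      (by simp [hp0])
    have := mem_unitDisk_iff.1 hz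
    exact div_nonneg (by linarith) (by positivity)
  induction n using Nat.strong_induction_on with
  | _ n ih =>
    match n, ih with
    | 0, _ => simp [taylorCoeff_zero, hf0]
    | 1, _ => simp [taylorCoeff_one, hf1]
    | n + 2, ih =>
      have e := taylorCoeff_mul hfd hp (n + 2)
      rw [← taylorCoeff_congr hfp, taylorCoeff_id_mul_deriv hfd,
        Finset.Nat.sum_antidiagonal_eq_sum_range_succ_mk, Finset.sum_range_succ] at e
      simp only [Nat.sub_self, taylorCoeff_zero, hp0, mul_one] at e
      -- In `z f' = f p` the term with `p(0) = 1` moves to the left. With `|p_m| ≤ 2` and the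
      -- induction hypothesis, the right side is at most `2 ∑ j = (n+1)(n+2)`.
      have e' : ((n + 1 : ℕ) : ℂ) * taylorCoeff f (n + 2) =
          ∑ j ∈ Finset.range (n + 2), taylorCoeff f j * taylorCoeff p (n + 2 - j) := by
        rw [← sub_eq_iff_eq_add.2 e]; push_cast; ring
      have hle : ((n + 1 : ℕ) : ℝ) * ‖taylorCoeff f (n + 2)‖ ≤
          ((n + 1 : ℕ) : ℝ) * ((n + 2 : ℕ) : ℝ) := by
        calc _ = ‖∑ j ∈ Finset.range (n + 2), taylorCoeff f j * taylorCoeff p (n + 2 - j)‖ := by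
              rw [← e', norm_mul, Complex.norm_natCast]
          _ ≤ ∑ j ∈ Finset.range (n + 2), (j : ℝ) * 2 := by
              refine norm_sum_le_of_le _ fun j hj => ?_
              have hj := Finset.mem_range.1 hj
              rw [norm_mul]
              gcongr
              · exact ih j hj
              · exact hpn (by omega)
          _ = _ := by
              rw [← Finset.sum_mul, ← Nat.cast_sum]
              have := Finset.sum_range_id_mul_two (n + 2)
              rw [show n + 2 - 1 = n + 1 by omega, mul_comm (n + 2)] at this
              exact_mod_cast this
      exact le_of_mul_le_mul_left hle (Nat.cast_pos.2 n.succ_pos)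

/-- A starlike function is `z exp(L(z))` with `z L'(z) = z f'(z) / f(z) - 1`. -/
lemma exists_log_of_mem_starlikeClass {f : ℂ → ℂ} (hf : f ∈ starlikeClass) :
    ∃ L L' : ℂ → ℂ, (∀ z ∈ unitDisk, HasDerivAt L (L' z) z) ∧ L 0 = 0 ∧
      (∀ z ∈ unitDisk, f z = z * Complex.exp (L z)) ∧
      ∀ z ∈ unitDisk, (1 - ‖z‖) / (1 + ‖z‖) ≤ (1 + z * L' z).re := by
  obtain ⟨p, hp, hp0, hfp, hre⟩ := exists_of_mem_starlikeClass hf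
  obtain ⟨⟨hfd, hf0, hf1⟩, hne, -⟩ := hf
  set F := dslope f 0
  have hF : DifferentiableOn ℂ F unitDisk := differentiableOn_dslope_zero hfd
  have hfF (z : ℂ) : f z = z * F z := by rw [eq_add_mul_dslope_zero f z, hf0, zero_add]
  have hF0 : F 0 = 1 := by rw [← hf1]; exact dslope_same f 0
  have hFne : ∀ z ∈ unitDisk, F z ≠ 0 := fun z hz h => by
    rcases eq_or_ne z 0 with rfl | hz0
    · exact one_ne_zero (hF0.symm.trans h)
    · exact hne z hz hz0 (by rw [hfF, h, mul_zero])
  have hFat {z : ℂ} (hz : z ∈ unitDisk) : HasDerivAt F (deriv F z) z :=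
    (hF.differentiableAt (isOpen_unitDisk.mem_nhds hz)).hasDerivAt
  -- A primitive of `F'/F`. It is a logarithm of `F = f(z)/z` because `F exp(-L)` has zero
  -- derivative and value 1 at the origin.
  obtain ⟨L, hL0, hL⟩ := (DifferentiableOn.isExactOn_ball
    ((hF.deriv isOpen_unitDisk).div hF hFne)).with_val_at 0 0
  refine ⟨L, fun z => deriv F z / F z, hL, hL0, fun z hz => ?_, fun z hz => ?_⟩
  · have hder : ∀ x ∈ unitDisk, HasDerivAt (fun y => F y * Complex.exp (-L y)) 0 x := by
      intro x hx
      have hder := (hFat hx).mul (hL x hx).neg.cexp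
      have e : deriv F x * Complex.exp (-L x) +
          F x * (Complex.exp (-L x) * -(deriv F x / F x)) = 0 := by
        have := hFne x hx
        field_simp
        ring
      exact e ▸ hder
    have hc : F z * Complex.exp (-L z) = F 0 * Complex.exp (-L 0) :=
      isOpen_unitDisk.is_const_of_deriv_eq_zero (convex_ball 0 1).isPreconnected
        (fun x hx => (hder x hx).differentiableAt.differentiableWithinAt)
        (fun x hx => (hder x hx).deriv) hz zero_mem_unitDisk
    rw [hF0, hL0, neg_zero, Complex.exp_zero, mul_one, Complex.exp_neg] at hc
    rw [hfF, (mul_inv_eq_one₀ (Complex.exp_ne_zero _)).1 hc]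
  · refine (hre z hz).trans_eq ?_
    congr 1
    rcases eq_or_ne z 0 with rfl | hz0
    · simp [hp0]
    · have h1 : deriv f z = F z + z * deriv F z := by
        have : f = fun z => z * F z := funext hfF
        have h := ((hasDerivAt_id' z).fun_mul (hFat hz)).deriv
        rwa [one_mul, ← this] at h
      have h2 := hfp z hz
      have h3 := hFne z hz
      rw [h1, hfF, mul_assoc] at h2
      have h4 := mul_left_cancel₀ hz0 h2
      field_simp
      rw [h4, mul_comm]

/-- The growth theorem for starlike functions. -/
theorem le_norm_of_mem_starlikeClass {f : ℂ → ℂ} (hf : f ∈ starlikeClass) {z : ℂ}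
    (hz : z ∈ unitDisk) : ‖z‖ / (1 + ‖z‖) ^ 2 ≤ ‖f z‖ := by
  obtain ⟨L, L', hL, hL0, hfL, hre⟩ := exists_log_of_mem_starlikeClass hf
  have hz1 := mem_unitDisk_iff.1 hz
  have hmem {t : ℝ} (ht : t ∈ Icc (0 : ℝ) 1) : (t : ℂ) * z ∈ unitDisk := by
    rw [mem_unitDisk_iff, norm_mul, Complex.norm_of_nonneg ht.1]
    exact (mul_le_of_le_one_left (norm_nonneg _) ht.2).trans_lt hz1
  -- Along the radius, the lower bound on `Re (1 + z L')` says that `Re L` decreases no faster than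
  -- `-2 log (1 + t|z|)`. So `φ` increases from 0, and `φ(1) ≥ 0` is the logarithm of the claim.
  set φ : ℝ → ℝ := fun t => (L (t * z)).re + 2 * Real.log (1 + t * ‖z‖) with hφ
  have hder {t : ℝ} (ht : t ∈ Icc (0 : ℝ) 1) :
      HasDerivAt φ ((z * L' (t * z)).re + 2 * (‖z‖ / (1 + t * ‖z‖))) t := by
    have h1 : HasDerivAt (fun s : ℂ => L (s * z)) (L' (t * z) * (1 * z)) (t : ℂ) :=
      (hL _ (hmem ht)).comp (t : ℂ) ((hasDerivAt_id (t : ℂ)).mul_const z)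
    have h2 := h1.real_of_complex
    have h3 : HasDerivAt (fun s : ℝ => 1 + s * ‖z‖) ‖z‖ t := by
      simpa using ((hasDerivAt_id t).mul_const ‖z‖).const_add 1
    have hpos : 1 + t * ‖z‖ ≠ 0 := by have := mul_nonneg ht.1 (norm_nonneg z); positivity
    have h4 := h2.add ((h3.log hpos).const_mul 2)
    rwa [one_mul, mul_comm (L' _)] at h4
  have hmono : MonotoneOn φ (Icc 0 1) := by
    refine monotoneOn_of_deriv_nonneg (convex_Icc 0 1)
      (fun t ht => (hder ht).continuousAt.continuousWithinAt)
      (fun t ht => (hder (interior_subset ht)).differentiableAt.differentiableWithinAt)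
      fun t ht => ?_
    rw [(hder (interior_subset ht)).deriv]
    rw [interior_Icc] at ht
    have h1 := hre _ (hmem (Ioo_subset_Icc_self ht))
    rw [norm_mul, Complex.norm_of_nonneg ht.1.le, Complex.add_re, Complex.one_re, mul_assoc,
      Complex.re_ofReal_mul] at h1
    have hpos : 0 < 1 + t * ‖z‖ := by have := mul_nonneg ht.1.le (norm_nonneg z); positivity
    have h2 : (1 - t * ‖z‖) / (1 + t * ‖z‖) = 1 - t * (2 * (‖z‖ / (1 + t * ‖z‖))) := by
      field_simp; ring
    rw [h2] at h1
    refine nonneg_of_mul_nonneg_right (a := t) ?_ ht.1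
    linarith
  have h01 := hmono (left_mem_Icc.2 zero_le_one) (right_mem_Icc.2 zero_le_one) zero_le_one
  simp only [hφ, Complex.ofReal_zero, zero_mul, hL0, Complex.zero_re, add_zero, Real.log_one,
    mul_zero, Complex.ofReal_one, one_mul] at h01
  have hpos : 0 < 1 + ‖z‖ := by positivity
  have hexp : ((1 + ‖z‖) ^ 2)⁻¹ ≤ Real.exp (L z).re := by
    rw [← Real.exp_log (inv_pos.2 (pow_pos hpos 2)), Real.log_inv, Real.log_pow]
    apply Real.exp_le_exp.2
    push_cast
    linarith
  rw [hfL z hz, norm_mul, Complex.norm_exp, div_eq_mul_inv]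
  gcongr

/-- **Noshiro–Warschawski**: a function whose derivative has positive real part on a convex set is
injective there. -/
lemma Convex.injOn_of_re_deriv_pos {s : Set ℂ} (hs : Convex ℝ s) {G G' : ℂ → ℂ}
    (hG : ∀ z ∈ s, HasDerivAt G (G' z) z) (hpos : ∀ z ∈ s, 0 < (G' z).re) : InjOn G s := by
  intro a ha b hb hab
  by_contra hne
  have hd : b - a ≠ 0 := sub_ne_zero.2 (Ne.symm hne)
  have hmem {t : ℝ} (ht : t ∈ Icc (0 : ℝ) 1) : a + (t : ℂ) * (b - a) ∈ s := by
    simpa using hs.add_smul_sub_mem ha hb ht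
  -- Division by `b - a` makes the derivative along the segment equal to `G'`.
  have hder {t : ℝ} (ht : t ∈ Icc (0 : ℝ) 1) :
      HasDerivAt (fun s : ℝ => (G (a + (s : ℂ) * (b - a)) / (b - a)).re)
        (G' (a + (t : ℂ) * (b - a))).re t := by
    have h1 : HasDerivAt (fun s : ℂ => a + s * (b - a)) (b - a) (t : ℂ) := by
      simpa using ((hasDerivAt_id (t : ℂ)).mul_const (b - a)).const_add a
    have h2 := (((hG _ (hmem ht)).comp (t : ℂ) h1).div_const (b - a)).real_of_complex
    rwa [mul_div_cancel_right₀ _ hd] at h2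
  have hmono := strictMonoOn_of_deriv_pos (convex_Icc (0 : ℝ) 1)
    (fun t ht => (hder ht).continuousAt.continuousWithinAt) fun t ht => by
      rw [(hder (interior_subset ht)).deriv]
      exact hpos _ (hmem (interior_subset ht))
  have := hmono (left_mem_Icc.2 zero_le_one) (right_mem_Icc.2 zero_le_one) zero_lt_one
  simp [hab] at this

/-- Starlike functions are univalent. -/
theorem injOn_of_mem_starlikeClass {f : ℂ → ℂ} (hf : f ∈ starlikeClass) : InjOn f unitDisk := by
  obtain ⟨L, L', hL, hL0, hfL, hre⟩ := exists_log_of_mem_starlikeClass hf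
  obtain ⟨⟨-, hf0, -⟩, hne, -⟩ := hf
  have hexp : ∀ ζ ∈ {ζ : ℂ | ζ.re < 0}, Complex.exp ζ ∈ unitDisk := fun ζ hζ => by
    rw [mem_unitDisk_iff, Complex.norm_exp]
    simpa using hζ
  -- In the coordinate `ζ = log z` the map `f` lifts to `log f = ζ + L(exp ζ)` on a half-plane,
  -- which is convex. The derivative there is `z f'/f`, of positive real part.
  have hinj : InjOn (fun ζ => ζ + L (Complex.exp ζ)) {ζ : ℂ | ζ.re < 0} := by
    refine (convex_halfSpace_re_lt 0).injOn_of_re_deriv_pos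
      (G' := fun ζ => 1 + L' (Complex.exp ζ) * Complex.exp ζ)
      (fun ζ hζ => (hasDerivAt_id ζ).add ((hL _ (hexp ζ hζ)).comp ζ (Complex.hasDerivAt_exp ζ)))
      fun ζ hζ => ?_
    have h1 := mem_unitDisk_iff.1 (hexp ζ hζ)
    simp only [mul_comm (L' _)]
    exact (div_pos (by linarith) (by positivity)).trans_le (hre _ (hexp ζ hζ))
  intro a ha b hb hab
  rcases eq_or_ne a 0 with rfl | ha0
  · by_contra h
    exact hne b hb (Ne.symm h) (hab ▸ hf0)
  rcases eq_or_ne b 0 with rfl | hb0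
  · exact absurd (hab.trans hf0) (hne a ha ha0)
  have hlog {z : ℂ} (hz : z ∈ unitDisk) (h0 : z ≠ 0) : (Complex.log z).re < 0 := by
    rw [Complex.log_re]
    exact Real.log_neg (norm_pos_iff.2 h0) (mem_unitDisk_iff.1 hz)
  have h1 : Complex.exp (Complex.log a + L a) = Complex.exp (Complex.log b + L b) := by
    rw [Complex.exp_add, Complex.exp_add, Complex.exp_log ha0, Complex.exp_log hb0, ← hfL a ha,
      ← hfL b hb, hab]
  -- Equal exponentials fix the lifts up to `2πi n`; the shifted logarithm of `b` stays in the
  -- half-plane and still represents `b`.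
  obtain ⟨n, hn⟩ := Complex.exp_eq_exp_iff_exists_int.1 h1
  have hb' : Complex.exp (Complex.log b + n * (2 * Real.pi * Complex.I)) = b := by
    rw [Complex.exp_add, Complex.exp_int_mul_two_pi_mul_I, mul_one, Complex.exp_log hb0]
  have h2 := hinj (hlog ha ha0)
    (show (Complex.log b + n * (2 * Real.pi * Complex.I)).re < 0 by simpa using hlog hb hb0)
    (show Complex.log a + L (Complex.exp (Complex.log a)) =
      Complex.log b + n * (2 * Real.pi * Complex.I) +
        L (Complex.exp (Complex.log b + n * (2 * Real.pi * Complex.I))) by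
      rw [Complex.exp_log ha0, hb', hn]; ring)
  rw [← hb', ← h2, Complex.exp_log ha0]

lemma deriv_ne_zero_of_mem_starlikeClass {f : ℂ → ℂ} (hf : f ∈ starlikeClass) {z : ℂ}
    (hz : z ∈ unitDisk) : deriv f z ≠ 0 := by
  obtain ⟨p, -, -, hfp, hre⟩ := exists_of_mem_starlikeClass hf
  obtain ⟨⟨-, -, hf1⟩, hne, -⟩ := hf
  rcases eq_or_ne z 0 with rfl | hz0
  · simp [hf1]
  · intro h
    have h1 := hfp z hz
    rw [h, mul_zero, eq_comm, mul_eq_zero, or_iff_right (hne z hz hz0)] at h1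
    have h2 := hre z hz
    have h3 := mem_unitDisk_iff.1 hz
    rw [h1, Complex.zero_re] at h2
    exact (div_pos (sub_pos.2 h3) (by positivity : 0 < 1 + ‖z‖)).not_ge h2

/-! ### Koebe's quarter theorem -/

/-- An injective analytic function on the disk with nonvanishing derivative omits a value. -/
lemma image_unitDisk_ne_univ {f : ℂ → ℂ} (hf : DifferentiableOn ℂ f unitDisk)
    (hinj : InjOn f unitDisk) (hne : ∀ z ∈ unitDisk, deriv f z ≠ 0) : f '' unitDisk ≠ univ := by
  intro h
  -- The inverse of a surjective `f` would be a bounded entire function, contradicting Liouville.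
  choose g hg hfg using fun y => (h ▸ mem_univ y : y ∈ f '' unitDisk)
  have hd : Differentiable ℂ g := fun y => by
    have h1 : HasStrictDerivAt f (deriv f (g y)) (g y) :=
      (hf.analyticAt (isOpen_unitDisk.mem_nhds (hg y))).hasStrictDerivAt
    have h2 := h1.to_local_left_inverse (g := g) (hne _ (hg y)) (by
      filter_upwards [isOpen_unitDisk.mem_nhds (hg y)] with x hx
      exact hinj (hg _) hx (hfg _))
    rw [hfg] at h2
    exact h2.hasDerivAt.differentiableAt
  have hb : Bornology.IsBounded (range g) :=
    isBounded_ball.subset (range_subset_iff.2 hg)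
  have := hd.apply_eq_apply_of_bounded hb 0 1
  exact zero_ne_one ((hfg 0).symm.trans ((congrArg f this).trans (hfg 1)))

lemma isOpen_image_unitDisk {f : ℂ → ℂ} (hf : DifferentiableOn ℂ f unitDisk)
    (hne : ∀ z ∈ unitDisk, deriv f z ≠ 0) {s : Set ℂ} (hs : s ⊆ unitDisk) (hso : IsOpen s) :
    IsOpen (f '' s) := by
  rcases (hf.analyticOnNhd isOpen_unitDisk).is_constant_or_isOpen
    (convex_ball 0 1).isPreconnected with ⟨c, hc⟩ | h
  · refine absurd ?_ (hne 0 zero_mem_unitDisk)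
    have : f =ᶠ[nhds 0] fun _ => c := Filter.eventuallyEq_of_mem unitDisk_mem_nhds_zero hc
    rw [this.deriv_eq, deriv_const]
  · exact h s hs hso

/-- **Koebe's quarter theorem** for starlike functions. -/
theorem one_quarter_le_boundaryDist {f : ℂ → ℂ} (hf : f ∈ starlikeClass) :
    1 / 4 ≤ boundaryDist f := by
  have hfd : DifferentiableOn ℂ f unitDisk := hf.1.1
  have hf0 : f 0 = 0 := hf.1.2.1
  have hne : ∀ z ∈ unitDisk, deriv f z ≠ 0 := fun z hz => deriv_ne_zero_of_mem_starlikeClass hf hz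
  -- Needed because `infDist` to the empty set is 0.
  have hfr : (frontier (f '' unitDisk)).Nonempty :=
    nonempty_frontier_iff.2 ⟨⟨f 0, mem_image_of_mem f zero_mem_unitDisk⟩,
      image_unitDisk_ne_univ hfd (injOn_of_mem_starlikeClass hf) hne⟩
  rw [boundaryDist, le_infDist hfr, hf0]
  intro y hy
  rw [dist_zero_left]
  by_contra! hlt
  rw [(isOpen_image_unitDisk hfd hne Subset.rfl isOpen_unitDisk).frontier_eq] at hy
  -- As `ρ/(1+ρ)²` tends to `1/4`, some `ρ < 1` works. By the growth theorem, image points near `y`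
  -- come from `|z| ≤ ρ`; the image of that disk is compact, so it contains `y`, whereas an open
  -- image misses its frontier.
  obtain ⟨ρ, hρy, hρ⟩ : ∃ ρ : ℝ, ‖y‖ < ρ / (1 + ρ) ^ 2 ∧ ρ ∈ Ioo (0 : ℝ) 1 := by
    have hc : ContinuousAt (fun ρ : ℝ => ρ / (1 + ρ) ^ 2) 1 :=
      continuousAt_id.div (by fun_prop) (by norm_num)
    have h1 : ∀ᶠ ρ in nhdsWithin (1 : ℝ) (Iio 1), ‖y‖ < ρ / (1 + ρ) ^ 2 :=
      (hc.eventually (lt_mem_nhds (by norm_num; linarith))).filter_mono nhdsWithin_le_nhds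
    exact (h1.and (Ioo_mem_nhdsLT zero_lt_one)).exists
  have hsub : closedBall (0 : ℂ) ρ ⊆ unitDisk := closedBall_subset_ball hρ.2
  have hU : ball (0 : ℂ) (ρ / (1 + ρ) ^ 2) ∈ nhds y :=
    isOpen_ball.mem_nhds (mem_ball_zero_iff.2 hρy)
  have hy1 : y ∈ closure (f '' unitDisk ∩ ball (0 : ℂ) (ρ / (1 + ρ) ^ 2)) := by
    rw [mem_closure_iff_nhds]
    intro t ht
    obtain ⟨x, ⟨hx1, hx2⟩, hx3⟩ := mem_closure_iff_nhds.1 hy.1 _ (Filter.inter_mem ht hU)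
    exact ⟨x, hx1, hx3, hx2⟩
  have hsub2 : f '' unitDisk ∩ ball (0 : ℂ) (ρ / (1 + ρ) ^ 2) ⊆ f '' closedBall 0 ρ := by
    rintro _ ⟨⟨z, hz, rfl⟩, hz2⟩
    refine ⟨z, ?_, rfl⟩
    rw [mem_closedBall_zero_iff]
    by_contra! hlt
    have h1 := (le_norm_of_mem_starlikeClass hf hz).trans_lt (mem_ball_zero_iff.1 hz2)
    have h2 := mem_unitDisk_iff.1 hz
    have h3 := hρ.1
    rw [div_lt_div_iff₀ (by positivity) (by positivity)] at h1
    -- Monotonicity of `t/(1+t)²`: cross-multiplied, the difference is `(|z| - ρ)(1 - |z|ρ)`.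
    nlinarith [mul_pos (sub_pos.2 hlt) (by nlinarith : 0 < 1 - ‖z‖ * ρ)]
  have hcomp : IsCompact (f '' closedBall 0 ρ) :=
    (isCompact_closedBall 0 ρ).image_of_continuousOn (hfd.continuousOn.mono hsub)
  exact hy.2 (image_mono hsub (hcomp.isClosed.closure_subset_iff.2 hsub2 hy1))

/-! ### Subordination of harmonic functions -/

/-- If `u = conj v` on the disk with `u`, `v` analytic, then their higher Taylor coefficients
vanish. -/
lemma taylorCoeff_eq_zero_of_eqOn_conj {u v : ℂ → ℂ} (hu : DifferentiableOn ℂ u unitDisk)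
    (hv : DifferentiableOn ℂ v unitDisk) (h : ∀ z ∈ unitDisk, u z = conj (v z)) {n : ℕ}
    (hn : n ≠ 0) : taylorCoeff u n = 0 ∧ taylorCoeff v n = 0 := by
  -- With zero real part, Carathéodory's bound is 0. This applies to `i(u + v)` and `u - v`, since
  -- `u + v` is real and `u - v` imaginary.
  have key {F : ℂ → ℂ} (hF : DifferentiableOn ℂ F unitDisk) (hre : ∀ z ∈ unitDisk, (F z).re = 0) :
      taylorCoeff F n = 0 := by
    have := norm_taylorCoeff_le_of_re_nonneg hF (fun z hz => (hre z hz).ge) hn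
    rw [hre 0 zero_mem_unitDisk, mul_zero] at this
    exact norm_le_zero_iff.1 this
  have hsum : taylorCoeff u n + taylorCoeff v n = 0 := by
    have := key (F := fun z => Complex.I * (u z + v z)) ((hu.add hv).const_mul _) fun z hz => by
      simp [h z hz]
    rw [taylorCoeff_const_mul, mul_eq_zero, or_iff_right Complex.I_ne_zero, taylorCoeff,
      iteratedDeriv_fun_add (hu.contDiffAt_zero n) (hv.contDiffAt_zero n), add_div] at this
    exact this
  have hdiff : taylorCoeff u n - taylorCoeff v n = 0 := by
    have := key (F := fun z => u z - v z) (hu.sub hv) fun z hz => by simp [h z hz]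
    rw [taylorCoeff, iteratedDeriv_fun_sub (hu.contDiffAt_zero n) (hv.contDiffAt_zero n),
      sub_div] at this
    exact this
  have e := sub_eq_zero.1 hdiff
  rw [e, ← two_mul, mul_eq_zero, or_iff_right two_ne_zero] at hsum
  exact ⟨e.trans hsum, hsum⟩

/-- Subordination of harmonic functions acts on the Taylor coefficients of the analytic and
co-analytic parts separately. -/
lemma IsHarmonicSubordinate.exists_schwarz {f₁ g₁ f g : ℂ → ℂ}
    (h : IsHarmonicSubordinate f₁ g₁ f g) (hf : DifferentiableOn ℂ f unitDisk)
    (hg : DifferentiableOn ℂ g unitDisk) :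
    ∃ w, IsSchwarz w ∧ ∀ n ≠ 0, taylorCoeff f₁ n = taylorCoeff (fun z => f (w z)) n ∧
      taylorCoeff g₁ n = taylorCoeff (fun z => g (w z)) n := by
  obtain ⟨w, hw, hsub⟩ := h.subordinate
  refine ⟨w, hw, fun n hn => ?_⟩
  have hfw : DifferentiableOn ℂ (fun z => f (w z)) unitDisk := hf.comp hw.analytic hw.mapsTo
  have hgw : DifferentiableOn ℂ (fun z => g (w z)) unitDisk := hg.comp hw.analytic hw.mapsTo
  obtain ⟨h1, h2⟩ := taylorCoeff_eq_zero_of_eqOn_conj (u := fun z => f₁ z - f (w z))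
    (v := fun z => g (w z) - g₁ z) (h.analytic_left.sub hfw) (hgw.sub h.analytic_right)
    (fun z hz => by
      have := hsub z hz
      simp only [harmonicMap] at this
      rw [map_sub, sub_eq_sub_iff_add_eq_add, this, add_comm]) hn
  rw [taylorCoeff, iteratedDeriv_fun_sub (h.analytic_left.contDiffAt_zero n)
    (hfw.contDiffAt_zero n), sub_div] at h1
  rw [taylorCoeff, iteratedDeriv_fun_sub (hgw.contDiffAt_zero n)
    (h.analytic_right.contDiffAt_zero n), sub_div] at h2
  exact ⟨sub_eq_zero.1 h1, (sub_eq_zero.1 h2).symm⟩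

/-! ### The Koebe function -/

lemma IsSchwarz.id : IsSchwarz fun z => z :=
  ⟨differentiableOn_id, mapsTo_id _, rfl⟩

lemma hasDerivAt_koebe {z : ℂ} (hz : z ∈ unitDisk) :
    HasDerivAt koebe ((1 + z) / (1 - z) ^ 3) z := by
  have h1 : 1 - z ≠ 0 := IsSchwarz.id.one_sub_ne_zero hz
  have h2 := (hasDerivAt_id' z).fun_div (((hasDerivAt_id' z).const_sub 1).fun_pow 2)
    (pow_ne_zero 2 h1)
  refine h2.congr_deriv ?_
  push_cast
  field_simp
  ring

lemma differentiableOn_koebe : DifferentiableOn ℂ koebe unitDisk := fun _ hz =>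
  (hasDerivAt_koebe hz).differentiableAt.differentiableWithinAt

lemma koebe_mem_starlikeClass : koebe ∈ starlikeClass := by
  refine ⟨⟨differentiableOn_koebe, by simp [koebe], ?_⟩, fun z hz h0 => ?_, fun z => z,
    IsSchwarz.id, fun z hz => ?_⟩
  · simp [(hasDerivAt_koebe zero_mem_unitDisk).deriv]
  · exact div_ne_zero h0 (pow_ne_zero 2 (IsSchwarz.id.one_sub_ne_zero hz))
  · have h1 : 1 - z ≠ 0 := IsSchwarz.id.one_sub_ne_zero hz
    rw [starlikeQuotient]
    split_ifs with h
    · simp [h]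
    · rw [(hasDerivAt_koebe hz).deriv, koebe]
      field_simp

/-- With `G = 1/(1-z)`, the identity `G = 1 + zG` makes all coefficients of `G` equal to 1, and the
Koebe function is `z G²`. -/
lemma taylorCoeff_koebe (n : ℕ) : taylorCoeff koebe n = n := by
  set G : ℂ → ℂ := fun z => (1 - z)⁻¹ with hGdef
  have hG : DifferentiableOn ℂ G unitDisk :=
    (differentiableOn_id.const_sub 1).inv fun z hz => IsSchwarz.id.one_sub_ne_zero hz
  have hGn (n : ℕ) : taylorCoeff G n = 1 := by
    induction n with
    | zero => simp [taylorCoeff_zero, hGdef]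
    | succ n ih =>
      have e : EqOn G (fun z => 1 + z * G z) unitDisk := fun z hz => by
        have h1 : 1 - z ≠ 0 := IsSchwarz.id.one_sub_ne_zero hz
        simp only [hGdef]
        field_simp
        ring
      rw [taylorCoeff_congr e, taylorCoeff_const_add_of_pos _ _ n.succ_pos,
        taylorCoeff_id_mul_succ hG, ih]
  have e : koebe = fun z => z * (G z * G z) := by
    ext z
    rw [koebe, div_eq_mul_inv, pow_two, mul_inv]
  cases n with
  | zero => simp [taylorCoeff_zero, koebe]
  | succ n =>
    rw [e, taylorCoeff_id_mul_succ (f := fun z => G z * G z) (hG.mul hG), taylorCoeff_mul hG hG]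
    simp [hGn]

/-- The affine map `ζ ↦ ζ + c conj ζ`, `|c| < 1`, as a homeomorphism of the plane. -/
noncomputable def addConjHomeomorph (c : ℝ) (hc : c ^ 2 ≠ 1) : ℂ ≃ₜ ℂ where
  toFun z := z + c * conj z
  invFun z := (z - c * conj z) / (1 - c ^ 2)
  left_inv z := by
    have : (1 : ℂ) - c ^ 2 ≠ 0 := sub_ne_zero.2 (by exact_mod_cast hc.symm)
    rw [div_eq_iff this]
    simp only [map_add, map_mul, Complex.conj_ofReal, Complex.conj_conj]
    ring
  right_inv z := by
    have : (1 : ℂ) - c ^ 2 ≠ 0 := sub_ne_zero.2 (by exact_mod_cast hc.symm)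
    simp only [map_div₀, map_sub, map_mul, Complex.conj_ofReal, Complex.conj_conj, map_one, map_pow]
    field_simp
    ring
  continuous_toFun := by fun_prop
  continuous_invFun := by fun_prop

lemma isOpenEmbedding_koebe : Topology.IsOpenEmbedding fun z : unitDisk => koebe z := by
  have hne : ∀ z ∈ unitDisk, deriv koebe z ≠ 0 := fun z hz =>
    deriv_ne_zero_of_mem_starlikeClass koebe_mem_starlikeClass hz
  refine .of_continuous_injective_isOpenMap differentiableOn_koebe.continuousOn.domRestrict
    (injOn_of_mem_starlikeClass koebe_mem_starlikeClass).injective fun s hs => ?_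
  have h := isOpen_image_unitDisk differentiableOn_koebe hne (Subtype.coe_image_subset _ s)
    (isOpen_unitDisk.isOpenMap_subtype_val s hs)
  rwa [image_image] at h

lemma isQuasiconformalHarmonic_koebe {K : ℝ} (hK : 1 ≤ K) :
    IsQuasiconformalHarmonic K koebe (scaledKoebe K) := by
  set k : ℝ := (K - 1) / (K + 1) with hk
  have hK1 : 0 < K + 1 := by linarith
  have hk0 : 0 ≤ k := div_nonneg (by linarith) hK1.le
  have hk1 : k < 1 := (div_lt_one hK1).2 (by linarith)
  have hg (z : ℂ) : scaledKoebe K z = k * koebe z := rfl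
  have hderiv {z : ℂ} (hz : z ∈ unitDisk) : ‖deriv (scaledKoebe K) z‖ = k * ‖deriv koebe z‖ := by
    have h : HasDerivAt (scaledKoebe K) _ z := (hasDerivAt_koebe hz).const_mul (k : ℂ)
    rw [h.deriv, norm_mul,
      Complex.norm_of_nonneg hk0, (hasDerivAt_koebe hz).deriv]
  refine ⟨⟨differentiableOn_koebe, differentiableOn_koebe.const_mul _, by simp [hg, koebe],
    fun z hz => ?_, fun z hz => ?_⟩, ?_⟩
  · rw [hderiv hz]
    exact mul_lt_of_lt_one_left
      (norm_pos_iff.2 (deriv_ne_zero_of_mem_starlikeClass koebe_mem_starlikeClass hz)) hk1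
  · rw [hderiv hz, hk]
    refine le_of_eq ?_
    field_simp
    ring
  · have hc : k ^ 2 ≠ 1 := by nlinarith
    convert (addConjHomeomorph k hc).isOpenEmbedding.comp isOpenEmbedding_koebe using 1
    ext z
    simp [harmonicMap, hg, addConjHomeomorph]

lemma isHarmonicSubordinate_koebe (K : ℝ) :
    IsHarmonicSubordinate koebe (scaledKoebe K) koebe (scaledKoebe K) :=
  ⟨differentiableOn_koebe, differentiableOn_koebe.const_mul _, by simp [scaledKoebe, koebe],
    fun z => z, IsSchwarz.id, fun _ _ => rfl⟩

/-- The point `-1/4` is the radial limit at `-1`, and it is omitted because `koebe z = -1/4` forces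
`(1 + z)² = 0`. -/
lemma boundaryDist_koebe : boundaryDist koebe = 1 / 4 := by
  refine le_antisymm ?_ (one_quarter_le_boundaryDist koebe_mem_starlikeClass)
  have hmem : (-1 / 4 : ℂ) ∈ frontier (koebe '' unitDisk) := by
    constructor
    · have ht : Filter.Tendsto (fun t : ℝ => koebe (-t)) (nhdsWithin 1 (Iio 1))
          (nhds (-1 / 4)) := by
        have hc : ContinuousAt (fun t : ℝ => koebe (-t)) 1 :=
          ContinuousAt.div (by fun_prop) (by fun_prop) (by norm_num)
        have : koebe (-(1 : ℝ)) = -1 / 4 := by norm_num [koebe]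
        exact this ▸ hc.tendsto.mono_left nhdsWithin_le_nhds
      refine mem_closure_of_tendsto ht ?_
      filter_upwards [Ioo_mem_nhdsLT (zero_lt_one (α := ℝ))] with t ht
      refine mem_image_of_mem _ (mem_unitDisk_iff.2 ?_)
      rw [norm_neg, Complex.norm_of_nonneg ht.1.le]
      exact ht.2
    · intro h
      obtain ⟨z, hz, hz'⟩ := interior_subset h
      have h1 : 1 - z ≠ 0 := IsSchwarz.id.one_sub_ne_zero hz
      rw [koebe, div_eq_div_iff (pow_ne_zero 2 h1) (by norm_num)] at hz'
      have h2 : (1 + z) ^ 2 = 0 := by linear_combination hz'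
      have h3 : z = -1 := by linear_combination pow_eq_zero_iff two_ne_zero |>.1 h2
      have h4 := mem_unitDisk_iff.1 hz
      rw [h3] at h4
      norm_num at h4
  refine (infDist_le_dist_of_mem hmem).trans_eq ?_
  rw [show koebe 0 = 0 by simp [koebe], dist_zero_left]
  norm_num

lemma hasSum_bohrTerm_koebe {K : ℝ} (hK : 1 ≤ K) {r : ℝ} (hr0 : 0 ≤ r) (hr1 : r < 1) :
    HasSum (bohrTerm koebe (scaledKoebe K) r) (2 * K / (K + 1) * (r / (1 - r) ^ 2)) := by
  have hK1 : 0 < K + 1 := by linarith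
  have h1 := hasSum_coe_mul_geometric_of_norm_lt_one (𝕜 := ℝ) (r := r)
    (by rwa [Real.norm_of_nonneg hr0])
  -- `bohrTerm` starts at exponent 1; the dropped term of `∑ n rⁿ` is zero.
  rw [← hasSum_nat_add_iff' 1] at h1
  simp only [Finset.range_one, Finset.sum_singleton, Nat.cast_zero, zero_mul, sub_zero] at h1
  have hk : 0 ≤ (K - 1) / (K + 1) := div_nonneg (by linarith) hK1.le
  refine (h1.mul_left (2 * K / (K + 1))).congr_fun fun n => ?_
  have e : taylorCoeff (scaledKoebe K) (n + 1) =
      (((K - 1) / (K + 1) : ℝ) : ℂ) * ((n + 1 : ℕ) : ℂ) := by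
    rw [← taylorCoeff_koebe]
    exact taylorCoeff_const_mul _ _ _
  rw [bohrTerm, e, taylorCoeff_koebe, norm_mul, Complex.norm_of_nonneg hk, Complex.norm_natCast]
  field_simp
  ring

/-! ### The Bohr radius and the main inequality -/

/-- The radius is the smaller root of this quadratic, which is `2K/(K+1) · r/(1-r)² = 1/4` with
denominators cleared. -/
lemma bohrRadius_spec {K : ℝ} (hK : 1 ≤ K) :
    (K + 1) * (1 - bohrRadius K) ^ 2 = 8 * K * bohrRadius K := by
  have hs : √(8 * K * (3 * K + 1)) ^ 2 = 8 * K * (3 * K + 1) := Real.sq_sqrt (by positivity)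
  have hK1 : K + 1 ≠ 0 := by positivity
  rw [bohrRadius]
  generalize √(8 * K * (3 * K + 1)) = s at hs
  field_simp
  linear_combination hs

lemma bohrRadius_pos {K : ℝ} (hK : 1 ≤ K) : 0 < bohrRadius K := by
  refine div_pos (sub_pos.2 ?_) (by positivity)
  rw [Real.sqrt_lt' (by positivity)]
  nlinarith

lemma bohrRadius_lt {K : ℝ} (hK : 1 ≤ K) : bohrRadius K < 1 / 3 := by
  rw [bohrRadius, div_lt_iff₀ (by positivity), sub_lt_comm]
  refine Real.lt_sqrt_of_sq_lt ?_
  nlinarith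

lemma two_mul_div_mul_eq_at_bohrRadius {K : ℝ} (hK : 1 ≤ K) :
    2 * K / (K + 1) * (bohrRadius K / (1 - bohrRadius K) ^ 2) = 1 / 4 := by
  have h1 : 0 < 1 - bohrRadius K := by linarith [bohrRadius_lt hK]
  have h2 := bohrRadius_spec hK
  rw [div_mul_div_comm, div_eq_iff (by positivity)]
  linear_combination -h2 / 4

lemma strictMonoOn_div_one_sub_sq : StrictMonoOn (fun r : ℝ => r / (1 - r) ^ 2) (Ico 0 1) := by
  intro a ha b hb hab
  have h1 : 0 < 1 - b := sub_pos.2 hb.2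
  have h2 : 1 - b < 1 - a := by linarith
  have h3 := ha.1
  have h4 : (1 - b) ^ 2 < (1 - a) ^ 2 := by gcongr
  exact (div_le_div_of_nonneg_left h3 (by positivity) h4.le).trans_lt
    (div_lt_div_of_pos_right hab (by positivity))

/-- The Bohr inequality for harmonic functions subordinate to a sense-preserving harmonic function
with bounded dilatation and starlike analytic part. -/
theorem bohr_inequality {K : ℝ} (hK : 1 ≤ K) {f g f₁ g₁ : ℂ → ℂ} (hf : f ∈ starlikeClass)
    (h : IsSensePreservingDilatationLE K f g) (h₁ : IsHarmonicSubordinate f₁ g₁ f g) {r : ℝ}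
    (hr : 0 ≤ r) (hrK : r ≤ bohrRadius K) :
    Summable (bohrTerm f₁ g₁ r) ∧ ∑' n, bohrTerm f₁ g₁ r n ≤ boundaryDist f := by
  have hK1 : 0 < K + 1 := by linarith
  have hr3 : r ≤ 1 / 3 := hrK.trans (bohrRadius_lt hK).le
  obtain ⟨w, hw, hcoeff⟩ := h₁.exists_schwarz h.analytic_left h.analytic_right
  have hk : ∀ z ∈ unitDisk, ‖deriv g z‖ ≤ (K - 1) / (K + 1) * ‖deriv f z‖ := fun z hz => by
    have := h.dilatation_le z hz
    rw [div_mul_eq_mul_div, le_div_iff₀ hK1]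
    linarith
  have hne : ∀ z ∈ unitDisk, deriv f z ≠ 0 := fun z hz =>
    deriv_ne_zero_of_mem_starlikeClass hf hz
  have hmaj (N : ℕ) : partialMajorant f r N ≤ r / (1 - r) ^ 2 := by
    refine (Finset.sum_le_sum fun m _ => mul_le_mul_of_nonneg_right
      (norm_taylorCoeff_le_of_mem_starlikeClass hf m) (pow_nonneg hr m)).trans ?_
    exact sum_le_hasSum _ (fun m _ => by positivity)
      (hasSum_coe_mul_geometric_of_norm_lt_one (by rw [Real.norm_of_nonneg hr]; linarith))
  have hshift (F : ℂ → ℂ) (N : ℕ) :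
      ∑ n ∈ Finset.range N, ‖taylorCoeff F (n + 1)‖ * r ^ (n + 1) ≤
        partialMajorant F r (N + 1) := by
    rw [partialMajorant_succ]
    exact le_add_of_nonneg_left (norm_nonneg _)
  have hpart (N : ℕ) : ∑ n ∈ Finset.range N, bohrTerm f₁ g₁ r n ≤ 1 / 4 := by
    calc ∑ n ∈ Finset.range N, bohrTerm f₁ g₁ r n
        = ∑ n ∈ Finset.range N, ‖taylorCoeff (fun z => f (w z)) (n + 1)‖ * r ^ (n + 1) +
          ∑ n ∈ Finset.range N, ‖taylorCoeff (fun z => g (w z)) (n + 1)‖ * r ^ (n + 1) := by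
          rw [← Finset.sum_add_distrib]
          refine Finset.sum_congr rfl fun n _ => ?_
          rw [bohrTerm, (hcoeff _ n.succ_ne_zero).1, (hcoeff _ n.succ_ne_zero).2, add_mul]
      _ ≤ partialMajorant f r (N + 1) + (K - 1) / (K + 1) * partialMajorant f r (N + 1) := by
          refine add_le_add ?_ ?_
          · exact (hshift _ N).trans (hw.partialMajorant_comp_le hr hr3 _ h.analytic_left)
          · exact ((hshift _ N).trans (hw.partialMajorant_comp_le hr hr3 _ h.analytic_right)).trans
              (partialMajorant_le_mul_of_norm_deriv_le h.analytic_left h.analytic_right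
                h.right_zero hne hk hr hr3 _)
      _ = 2 * K / (K + 1) * partialMajorant f r (N + 1) := by field_simp; ring
      _ ≤ 2 * K / (K + 1) * (bohrRadius K / (1 - bohrRadius K) ^ 2) := by
          refine mul_le_mul_of_nonneg_left ((hmaj _).trans ?_) (by positivity)
          exact strictMonoOn_div_one_sub_sq.monotoneOn ⟨hr, by linarith⟩
            ⟨(bohrRadius_pos hK).le, by linarith [bohrRadius_lt hK]⟩ hrK
      _ = 1 / 4 := two_mul_div_mul_eq_at_bohrRadius hK
  have hnn (n : ℕ) : 0 ≤ bohrTerm f₁ g₁ r n := by rw [bohrTerm]; positivity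
  exact ⟨summable_of_sum_range_le hnn hpart,
    (Real.tsum_le_of_sum_range_le hnn hpart).trans (one_quarter_le_boundaryDist hf)⟩

theorem mainTheorem4 (K : ℝ) (hK : 1 ≤ K) :
    (0 < bohrRadius K ∧ bohrRadius K < 1 / 3) ∧
    -- the Bohr inequality for all `r ≤ r₀`
    (∀ f g f₁ g₁ : ℂ → ℂ, f ∈ starlikeClass → IsSensePreservingDilatationLE K f g →
      IsHarmonicSubordinate f₁ g₁ f g →
      ∀ r : ℝ, 0 ≤ r → r ≤ bohrRadius K →
        Summable (bohrTerm f₁ g₁ r) ∧ ∑' n, bohrTerm f₁ g₁ r n ≤ boundaryDist f) ∧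
    -- sharpness: the extremal mapping `p = f₀ + k conj f₀`, with `f₀` the Koebe function
    (koebe ∈ starlikeClass ∧
      IsQuasiconformalHarmonic K koebe (scaledKoebe K) ∧
      IsHarmonicSubordinate koebe (scaledKoebe K) koebe (scaledKoebe K) ∧
      ∑' n, bohrTerm koebe (scaledKoebe K) (bohrRadius K) n = boundaryDist koebe ∧
      ∀ r : ℝ, bohrRadius K < r → r < 1 →
        Summable (bohrTerm koebe (scaledKoebe K) r) ∧
          boundaryDist koebe < ∑' n, bohrTerm koebe (scaledKoebe K) r n) := by
  have h0 := bohrRadius_pos hK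
  have h1 : bohrRadius K < 1 := (bohrRadius_lt hK).trans (by norm_num)
  refine ⟨⟨h0, bohrRadius_lt hK⟩,
    fun f g f₁ g₁ hf h h₁ r hr hrK => bohr_inequality hK hf h h₁ hr hrK,
    koebe_mem_starlikeClass, isQuasiconformalHarmonic_koebe hK, isHarmonicSubordinate_koebe K,
    ?_, fun r hr hr1 => ?_⟩
  · rw [(hasSum_bohrTerm_koebe hK h0.le h1).tsum_eq, boundaryDist_koebe,
      two_mul_div_mul_eq_at_bohrRadius hK]
  · have hsum := hasSum_bohrTerm_koebe hK (h0.trans hr).le hr1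
    refine ⟨hsum.summable, ?_⟩
    rw [hsum.tsum_eq, boundaryDist_koebe, ← two_mul_div_mul_eq_at_bohrRadius hK]
    have hpos : 0 < 2 * K / (K + 1) := by positivity
    exact mul_lt_mul_of_pos_left
      (strictMonoOn_div_one_sub_sq ⟨h0.le, h1⟩ ⟨(h0.trans hr).le, hr1⟩ hr) hpos
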